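/- Let $T$ be a complex torus, i.e. a complex manifold biholomorphic to $V/\Lambda$, where $V$ is a finite-dimensional complex vector space and $\Lambda\subset V$ is a lattice of full rank. Let $f\colon T\to T$ be an int-amplified endomorphism, i.e. a surjective holomorphic map for which there exist Kähler classes $[\xi],[\eta]$ in the Bott–Chern cohomology $H^{1,1}_{\mathrm{BC}}(T)$ (smooth closed real $(1,1)$-forms modulo $dd^c$ of smooth real functions on $T$; a class is Kähler if it contains a Kähler form) such that $f^*[\xi]-[\xi]=[\eta]$. Then $f$ has a fixed point, i.e. there is $p\in T$ with $f(p)=p$. -/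

import Mathlib

open Set Function Topology
open scoped Manifold ContDiff

noncomputable section

namespace KahlerTorus

/-! ### Real two-forms on a complex manifold -/

section Manifold

variable {E : Type*} [NormedAddCommGroup E] [NormedSpace ℂ E]
variable {M : Type*} [TopologicalSpace M] [ChartedSpace E M]
variable {N : Type*} [TopologicalSpace N] [ChartedSpace E N]

variable (E M) in
/-- Real (not necessarily continuous) differential two-forms on a complex manifold `M` modelled on
the complex vector space `E`. The tangent spaces are complex vector spaces; multiplication by
`Complex.I` is the complex structure `J`. -/
abbrev TwoForm : Type _ :=
  ∀ x : M, TangentSpace 𝓘(ℂ, E) x [⋀^Fin 2]→L[ℝ] ℝ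

/-- The pull-back `f^* α` of a two-form by a (holomorphic) map. -/
def pullback (f : M → N) (α : TwoForm E N) : TwoForm E M := fun x =>
  (α (f x)).compContinuousLinearMap
    ((mfderiv 𝓘(ℂ, E) 𝓘(ℂ, E) f x).restrictScalars ℝ)

/-- The expression of a two-form in the preferred chart at `x₀`, i.e. its pull-back by the inverse
of the chart; it is meaningful on the target of the chart. -/
def inChart (α : TwoForm E M) (x₀ : M) (y : E) : E [⋀^Fin 2]→L[ℝ] ℝ :=
  pullback (M := E) (N := M) (extChartAt 𝓘(ℂ, E) x₀).symm α y

/-- The two-form `α` is smooth (in the real sense). -/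
def IsSmooth (α : TwoForm E M) : Prop :=
  ∀ x₀ : M, ContDiffOn ℝ ∞ (inChart α x₀) (extChartAt 𝓘(ℂ, E) x₀).target

/-- The two-form `α` is closed, `dα = 0`. -/
def IsClosedForm (α : TwoForm E M) : Prop :=
  ∀ x₀ : M, ∀ y ∈ (extChartAt 𝓘(ℂ, E) x₀).target, extDeriv (inChart α x₀) y = 0

/-- The real two-form `α` is of type `(1,1)`, that is `α (J v, J w) = α (v, w)`. -/
def IsOneOne (α : TwoForm E M) : Prop :=
  ∀ (x : M) (v w : TangentSpace 𝓘(ℂ, E) x),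
    α x ![Complex.I • v, Complex.I • w] = α x ![v, w]

/-- A Kähler form: a smooth closed real `(1,1)`-form that is positive definite,
`α (v, J v) > 0` for every tangent vector `v ≠ 0`. -/
structure IsKahlerForm (α : TwoForm E M) : Prop where
  smooth : IsSmooth α
  closed : IsClosedForm α
  oneOne : IsOneOne α
  pos : ∀ (x : M) (v : TangentSpace 𝓘(ℂ, E) x), v ≠ 0 → 0 < α x ![v, Complex.I • v]

/-- On the vector space `E`, the one-form `d^c u = i (∂̄ - ∂) u`, that is
`(d^c u) (v) = - du (J v)`. -/
def vectorDc (u : E → ℝ) (y : E) : E [⋀^Fin 1]→L[ℝ] ℝ :=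
  ContinuousAlternatingMap.ofSubsingleton ℝ E ℝ 0
    (-((fderiv ℝ u y).comp ((Complex.I • ContinuousLinearMap.id ℂ E).restrictScalars ℝ)))

/-- The two-form `dd^c φ = 2i ∂∂̄φ` on a complex manifold. Its value at `x` is computed in the
preferred chart at `x`, as `d (d^c u)` for the expression `u` of `φ` in that chart. -/
def ddc (φ : M → ℝ) : TwoForm E M := fun x =>
  (extDeriv (vectorDc (φ ∘ (extChartAt 𝓘(ℂ, E) x).symm))
      (extChartAt 𝓘(ℂ, E) x x)).compContinuousLinearMap
    ((mfderiv 𝓘(ℂ, E) 𝓘(ℂ, E) (extChartAt 𝓘(ℂ, E) x) x).restrictScalars ℝ)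

/-- Equality of Bott-Chern classes: `[α] = [β]` in `H^{1,1}_BC(M)` if and only if
`α - β = dd^c φ` for a globally defined smooth real function `φ`. -/
def SameBottChernClass (α β : TwoForm E M) : Prop :=
  ∃ φ : M → ℝ, ContMDiff 𝓘(ℝ, E) 𝓘(ℝ, ℝ) ∞ φ ∧ α - β = ddc φ

variable (E) in
/-- An endomorphism of a complex manifold: a surjective holomorphic self-map. -/
structure IsEndomorphism (f : M → M) : Prop where
  holomorphic : MDifferentiable 𝓘(ℂ, E) 𝓘(ℂ, E) f
  surjective : Surjective f

variable (E) in
/-- An int-amplified endomorphism: an endomorphism `f` such that `f^*[ξ] - [ξ] = [η]` in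
`H^{1,1}_BC(M)` for some Kähler classes `[ξ]` and `[η]`. -/
structure IsIntAmplified (f : M → M) : Prop extends IsEndomorphism E f where
  exists_kahler : ∃ ξ η : TwoForm E M, IsKahlerForm ξ ∧ IsKahlerForm η ∧
    SameBottChernClass (pullback f ξ - ξ) η

end Manifold

/-! ### Complex tori -/

section Torus

theorem isLocalHomeomorph_mk {E : Type*} [NormedAddCommGroup E] (Λ : Submodule ℤ E) [DiscreteTopology Λ] :
    IsLocalHomeomorph (Submodule.Quotient.mk : E → E ⧸ Λ) := by
  have h := AddSubgroup.isAddQuotientCoveringMap_of_comm Λ.toAddSubgroup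
    ⟨‹DiscreteTopology Λ›⟩
  exact h.isCoveringMap.isLocalHomeomorph

/-- The complex manifold structure on the quotient `E ⧸ Λ` of a complex vector space by a discrete
subgroup: the charts are local inverses of the projection `E → E ⧸ Λ`. -/
instance quotientChartedSpace {E : Type*} [NormedAddCommGroup E] (Λ : Submodule ℤ E) [DiscreteTopology Λ] :
    ChartedSpace E (E ⧸ Λ) :=
  (isLocalHomeomorph_mk Λ).chartedSpace (Submodule.Quotient.mk_surjective Λ)

/-- A chart of `E ⧸ Λ` composed with the projection is locally a translation. -/
theorem localInverseAt_mk_eventuallyEq {E : Type*} [NormedAddCommGroup E]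
    (Λ : Submodule ℤ E) [DiscreteTopology Λ] (q : E) {x : E}
    (hx : (Submodule.Quotient.mk x : E ⧸ Λ) ∈
      ((isLocalHomeomorph_mk Λ).localInverseAt q).source) :
    ∃ c : E, (fun y => (isLocalHomeomorph_mk Λ).localInverseAt q (Submodule.Quotient.mk y))
      =ᶠ[𝓝 x] fun y => y + c := by
  set h := isLocalHomeomorph_mk Λ
  set e := h.localInverseAt q
  have hcont : ContinuousAt (fun y => e (Submodule.Quotient.mk y)) x :=
    (e.continuousAt hx).comp h.continuous.continuousAt
  have hs : ∀ᶠ y in 𝓝 x, (Submodule.Quotient.mk y : E ⧸ Λ) ∈ e.source :=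
    h.continuous.continuousAt.preimage_mem_nhds (e.open_source.mem_nhds hx)
  have hmem : ∀ᶠ y in 𝓝 x, e (Submodule.Quotient.mk y) - y ∈ Λ := by
    filter_upwards [hs] with y hy
    exact (Submodule.Quotient.eq Λ).1 (h.apply_localInverseAt_of_mem hy)
  set c := e (Submodule.Quotient.mk x) - x with hc
  have hcΛ : c ∈ Λ := hmem.self_of_nhds
  obtain ⟨U, hU, hUc⟩ : ∃ U ∈ 𝓝 c, ∀ z ∈ U, z ∈ Λ → z = c := by
    have := nhds_discrete Λ
    have h1 : ({⟨c, hcΛ⟩} : Set Λ) ∈ 𝓝 (⟨c, hcΛ⟩ : Λ) := by rw [this]; simp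
    rw [nhds_subtype, Filter.mem_comap] at h1
    obtain ⟨U, hU, h2⟩ := h1
    exact ⟨U, hU, fun z hz hz' => congrArg Subtype.val (h2 (show (⟨z, hz'⟩ : Λ) ∈ _ from hz))⟩
  have h3 : ContinuousAt (fun y => e (Submodule.Quotient.mk y) - y) x := hcont.sub continuousAt_id
  refine ⟨c, ?_⟩
  filter_upwards [hmem, h3.preimage_mem_nhds hU] with y h4 h5
  have := hUc _ h5 h4
  rw [← this]; simp

instance quotientIsManifold {E : Type*} [NormedAddCommGroup E] [NormedSpace ℂ E]
    (Λ : Submodule ℤ E) [DiscreteTopology Λ] : IsManifold 𝓘(ℂ, E) ω (E ⧸ Λ) := by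
  apply isManifold_of_contDiffOn
  rintro _ _ ⟨a, rfl⟩ ⟨b, rfl⟩ x hx
  simp [chartAt_self_eq] at hx ⊢
  obtain ⟨c, hc⟩ := localInverseAt_mk_eventuallyEq Λ _ hx.2
  refine ContDiffAt.contDiffWithinAt ?_
  exact (contDiffAt_id.add contDiffAt_const).congr_of_eventuallyEq hc

/-- A complex manifold `T` modelled on `E` is a complex torus if it is biholomorphic to the quotient
`E ⧸ Λ` by a lattice of full rank. -/
def IsComplexTorus (E : Type*) [NormedAddCommGroup E] [NormedSpace ℂ E]
    (T : Type*) [TopologicalSpace T] [ChartedSpace E T] : Prop :=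
  ∃ (Λ : Submodule ℤ E) (_ : DiscreteTopology Λ),
    IsZLattice ℝ Λ ∧ Nonempty (T ≃ₘ^ω⟮𝓘(ℂ, E), 𝓘(ℂ, E)⟯ (E ⧸ Λ))

end Torus

end KahlerTorus

end

noncomputable section

namespace KahlerTorus

/-! ### Haar averages on a compact group -/

section CompactGroup

open MeasureTheory

/-! By covering theory and Liouville's theorem, `f` lifts to an affine map `F z = A z + b` of `E`
(`eq_fderiv_add_of_sub_mem`). If `1` is not an eigenvalue of `A`, solving `A z - z = -b` gives a
fixed point.

Otherwise `A v = v` for some `v ≠ 0`, and also `A (Jv) = Jv`. Pull `f^*ξ - ξ - η = dd^c φ` back to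
`E` and evaluate it on `(v, Jv)`. With `G`, `H` the resulting components of `ξ`, `η`, this reads `G
∘ F - G - H = (dd^c φ)(v, Jv)`, because `F` fixes both directions. Average over the torus: `G ∘ F -
G` contributes zero, since a surjective affine map preserves Haar measure, and the exact term
contributes zero, being a difference of directional derivatives of periodic functions. Hence `H` has
mean zero, although it is positive because `η` is Kähler
(`not_forall_pos_of_eq_coboundary_add_extDeriv`). -/

theorem integrable_of_continuous_compactSpace {Q : Type*} [TopologicalSpace Q] [CompactSpace Q]
    [MeasurableSpace Q] [BorelSpace Q] (μ : Measure Q) [IsFiniteMeasure μ] {g : Q → ℝ}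
    (hg : Continuous g) : Integrable g μ := by
  obtain ⟨C, hC⟩ := (isCompact_range hg).isBounded.exists_norm_le
  exact Integrable.of_bound hg.aestronglyMeasurable C
    (Filter.Eventually.of_forall fun q => hC _ ⟨q, rfl⟩)

variable {Q : Type*} [AddCommGroup Q] [TopologicalSpace Q] [IsTopologicalAddGroup Q]
  [CompactSpace Q] [MeasurableSpace Q] [BorelSpace Q]

/-- Haar measure of a compact group is invariant under surjective affine maps. -/
theorem integral_comp_addMonoidHom_add (μ : Measure Q) [μ.IsAddHaarMeasure] (ψ : Q →+ Q)
    (hψ : Continuous ψ) (hsurj : Surjective ψ) (c : Q) {g : Q → ℝ} (hg : Continuous g) :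
    ∫ q, g (ψ q + c) ∂μ = ∫ q, g q ∂μ := by
  -- The image of Haar measure under a continuous surjective endomorphism is a Haar measure of the
  -- same total mass, hence the same measure.
  have h1 : MeasurePreserving ψ μ μ := AddMonoidHom.measurePreserving hψ hsurj rfl
  have h2 : ∫ q, g (q + c) ∂μ = ∫ q, g q ∂μ := integral_add_right_eq_self g c
  rw [← h2]
  conv_rhs => rw [← h1.map_eq]
  rw [integral_map hψ.measurable.aemeasurable]
  exact (hg.comp (continuous_id.add continuous_const)).aestronglyMeasurable

/-- The derivative of a continuous function along a one-parameter subgroup of a compact group has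
vanishing integral. -/
theorem integral_deriv_along_eq_zero (μ : Measure Q) [μ.IsAddHaarMeasure] (γ : ℝ → Q)
    (hγ : γ 0 = 0) {u d : Q → ℝ} (hu : Continuous u) (hd : Continuous d)
    (hud : ∀ q t, HasDerivAt (fun s => u (q + γ s)) (d (q + γ t)) t) :
    ∫ q, d q ∂μ = 0 := by
  obtain ⟨C, hC⟩ := (isCompact_range hd).isBounded.exists_norm_le
  have key := hasDerivAt_integral_of_dominated_loc_of_deriv_le (μ := μ)
    (F := fun t q => u (q + γ t)) (F' := fun t q => d (q + γ t)) (x₀ := (0 : ℝ))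
    (s := univ) (bound := fun _ => C) Filter.univ_mem
    (Filter.Eventually.of_forall fun t =>
      (hu.comp (continuous_id.add continuous_const)).aestronglyMeasurable)
    (integrable_of_continuous_compactSpace μ (hu.comp (continuous_id.add continuous_const)))
    (hd.comp (continuous_id.add continuous_const)).aestronglyMeasurable
    (Filter.Eventually.of_forall fun q t _ => hC _ ⟨_, rfl⟩)
    (integrable_const C)
    (Filter.Eventually.of_forall fun q t _ => hud q t)
  -- By translation invariance the integral does not depend on `t`, so its derivative at `0`
  -- vanishes.
  have h1 : (fun t => ∫ q, u (q + γ t) ∂μ) = fun _ => ∫ q, u q ∂μ :=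
    funext fun t => integral_add_right_eq_self u (γ t)
  have h2 := key.2
  rw [h1] at h2
  have h3 := h2.unique (hasDerivAt_const (0 : ℝ) _)
  simpa [hγ] using h3

/-- A positive continuous function on a compact group is not the sum of a coboundary of a
surjective affine map and of derivatives along one-parameter subgroups. -/
theorem not_forall_pos_of_eq_coboundary_add_deriv (ψ : Q →+ Q)
    (hψ : Continuous ψ) (hsurj : Surjective ψ) (c : Q) (γ₁ γ₂ : ℝ → Q)
    (hγ₁ : γ₁ 0 = 0) (hγ₂ : γ₂ 0 = 0) {g e u₁ d₁ u₂ d₂ : Q → ℝ}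
    (hg : Continuous g) (he : Continuous e) (hu₁ : Continuous u₁) (hd₁ : Continuous d₁)
    (hu₂ : Continuous u₂) (hd₂ : Continuous d₂)
    (h₁ : ∀ q t, HasDerivAt (fun s => u₁ (q + γ₁ s)) (d₁ (q + γ₁ t)) t)
    (h₂ : ∀ q t, HasDerivAt (fun s => u₂ (q + γ₂ s)) (d₂ (q + γ₂ t)) t)
    (heq : ∀ q, e q = g (ψ q + c) - g q - (d₁ q - d₂ q)) : ¬ ∀ q, 0 < e q := by
  intro hpos
  let μ : Measure Q := Measure.addHaar
  have hint : ∀ {k : Q → ℝ}, Continuous k → Integrable k μ :=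
    fun hk => integrable_of_continuous_compactSpace μ hk
  have hgc : Continuous fun q => g (ψ q + c) := hg.comp (hψ.add continuous_const)
  have h0 : ∫ q, e q ∂μ = 0 := by
    have h1 := integral_sub (hint (hgc.sub hg)) (hint (hd₁.sub hd₂))
    have h2 := integral_sub (hint hgc) (hint hg)
    have h3 := integral_sub (hint hd₁) (hint hd₂)
    simp only [Pi.sub_apply] at h1 h2 h3
    simp_rw [heq]
    rw [h1, h2, h3,
      integral_comp_addMonoidHom_add μ ψ hψ hsurj c hg,
      integral_deriv_along_eq_zero μ γ₁ hγ₁ hu₁ hd₁ h₁,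
      integral_deriv_along_eq_zero μ γ₂ hγ₂ hu₂ hd₂ h₂]
    simp
  have : 0 < ∫ q, e q ∂μ :=
    he.integral_pos_of_hasCompactSupport_nonneg_nonzero (HasCompactSupport.of_compactSpace e)
      (fun q => (hpos q).le) (hpos 0).ne'
  exact this.ne' h0

end CompactGroup

/-! ### Holomorphic invariance of `d^c` and `dd^c` on `E` -/

section LocalCalculus

variable {E : Type*} [NormedAddCommGroup E] [NormedSpace ℂ E]

/-- Complex linearity of the derivative of `h` is what lets it commute with `J`. -/
theorem vectorDc_comp {u : E → ℝ} {h : E → E} {y : E} (hu : DifferentiableAt ℝ u (h y))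
    (hh : DifferentiableAt ℂ h y) :
    vectorDc (u ∘ h) y =
      (vectorDc u (h y)).compContinuousLinearMap (fderiv ℝ h y) := by
  have h1 : HasFDerivAt h ((fderiv ℂ h y).restrictScalars ℝ) y :=
    hh.hasFDerivAt.restrictScalars ℝ
  have h2 := (hu.hasFDerivAt.comp y h1).fderiv
  ext w
  simp [vectorDc, h2, h1.fderiv]

theorem contDiffAt_vectorDc {u : E → ℝ} {y : E} (hu : ContDiffAt ℝ ∞ u y) :
    ContDiffAt ℝ ∞ (vectorDc u) y := by
  have h1 : ContDiffAt ℝ ∞ (fderiv ℝ u) y := hu.fderiv_right (by simp)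
  have h2 : ContDiffAt ℝ ∞ (fun y => -((fderiv ℝ u y).comp
      ((Complex.I • ContinuousLinearMap.id ℂ E).restrictScalars ℝ))) y :=
    (h1.clm_comp contDiffAt_const).neg
  exact ((ContinuousAlternatingMap.ofSubsingletonLIE (𝕜 := ℝ) (E := E) (F := ℝ)
    (0 : Fin 1)).toContinuousLinearEquiv.contDiff.contDiffAt).comp y h2

theorem extDeriv_vectorDc_comp {u : E → ℝ} {h : E → E} {y : E} (hu : ContDiffAt ℝ ∞ u (h y))
    (hh : ContDiffAt ℂ ω h y) :
    extDeriv (vectorDc (u ∘ h)) y =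
      (extDeriv (vectorDc u) (h y)).compContinuousLinearMap (fderiv ℝ h y) := by
  have hh' : ContDiffAt ℝ ∞ h y := (hh.restrict_scalars ℝ).of_le le_top
  have h2 : minSmoothness ℝ 2 ≤ (∞ : WithTop ℕ∞) := by
    rw [minSmoothness_of_isRCLikeNormedField]
    exact WithTop.coe_le_coe.2 (le_top : (2 : ℕ∞) ≤ ⊤)
  rw [← extDeriv_pullback ((contDiffAt_vectorDc hu).differentiableAt (by simp)) hh' h2]
  apply Filter.EventuallyEq.extDeriv_eq
  have h1 : ∀ᶠ z in 𝓝 y, ContDiffAt ℂ ω h z := hh.eventually (by simp)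
  have h2 : ∀ᶠ z in 𝓝 (h y), ContDiffAt ℝ 1 u z :=
    (hu.of_le (by simp)).eventually (by simp)
  filter_upwards [h1, hh.continuousAt.eventually h2] with z hz1 hz2
  exact vectorDc_comp (hz2.differentiableAt (by simp)) (hz1.differentiableAt (by simp))

end LocalCalculus

/-! ### Pulling forms and functions back to `E` -/

section Manifold

variable {E : Type*} [NormedAddCommGroup E] [NormedSpace ℂ E]
variable {T : Type*} [TopologicalSpace T] [ChartedSpace E T] [IsManifold 𝓘(ℂ, E) ω T]

theorem contDiffAt_extChartAt_comp {p : E → T} (hp : ContMDiff 𝓘(ℂ, E) 𝓘(ℂ, E) ω p) (x : T) {z : E}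
    (hz : p z ∈ (extChartAt 𝓘(ℂ, E) x).source) :
    ContDiffAt ℂ ω (extChartAt 𝓘(ℂ, E) x ∘ p) z := by
  rw [← contMDiffAt_iff_contDiffAt]
  exact (contMDiffAt_extChartAt' (by simpa using hz)).comp z (hp z)

theorem fderiv_extChartAt_comp {p : E → T} (hp : ContMDiff 𝓘(ℂ, E) 𝓘(ℂ, E) ω p) (x : T) {z : E}
    (hz : p z ∈ (extChartAt 𝓘(ℂ, E) x).source) :
    fderiv ℂ (extChartAt 𝓘(ℂ, E) x ∘ p) z =
      (mfderiv 𝓘(ℂ, E) 𝓘(ℂ, E) (extChartAt 𝓘(ℂ, E) x) (p z)).comp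
        (mfderiv 𝓘(ℂ, E) 𝓘(ℂ, E) p z) := by
  rw [← mfderiv_eq_fderiv]
  exact mfderiv_comp z (mdifferentiableAt_extChartAt (by simpa using hz))
    ((hp z).mdifferentiableAt (by simp))

/-- Factoring `p` through a chart brings its derivative to the shape used by `inChart`, so that
smoothness in charts can be transferred to pull-backs. -/
theorem mfderiv_apply_eq_fderiv_extChartAt_comp {p : E → T}
    (hp : ContMDiff 𝓘(ℂ, E) 𝓘(ℂ, E) ω p) (x : T) {z : E}
    (hz : p z ∈ (extChartAt 𝓘(ℂ, E) x).source) (v : E) :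
    (mfderiv 𝓘(ℂ, E) 𝓘(ℂ, E) p z : E → E) v =
      (mfderiv 𝓘(ℂ, E) 𝓘(ℂ, E) (extChartAt 𝓘(ℂ, E) x).symm (extChartAt 𝓘(ℂ, E) x (p z)) : E → E)
        (fderiv ℂ (extChartAt 𝓘(ℂ, E) x ∘ p) z v) := by
  have hd := (contDiffAt_extChartAt_comp hp x hz).differentiableAt (by simp)
  have h1 : (extChartAt 𝓘(ℂ, E) x).symm ∘ (extChartAt 𝓘(ℂ, E) x ∘ p) =ᶠ[𝓝 z] p := by
    have := hp.continuous.continuousAt.preimage_mem_nhds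
      (extChartAt_source_mem_nhds' (I := 𝓘(ℂ, E)) hz)
    filter_upwards [this] with w hw
    exact (extChartAt 𝓘(ℂ, E) x).left_inv hw
  have h2 : MDifferentiableAt 𝓘(ℂ, E) 𝓘(ℂ, E) (extChartAt 𝓘(ℂ, E) x).symm
      (extChartAt 𝓘(ℂ, E) x (p z)) := by
    have := mdifferentiableWithinAt_extChartAt_symm (I := 𝓘(ℂ, E))
      ((extChartAt 𝓘(ℂ, E) x).map_source hz)
    rwa [modelWithCornersSelf_coe, range_id, mdifferentiableWithinAt_univ] at this
  have h3 : HasMFDerivAt 𝓘(ℂ, E) 𝓘(ℂ, E) ((extChartAt 𝓘(ℂ, E) x).symm ∘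
      (extChartAt 𝓘(ℂ, E) x ∘ p)) z _ :=
    h2.hasMFDerivAt.comp z hd.hasFDerivAt.hasMFDerivAt
  have h4 := (h3.congr_of_eventuallyEq h1.symm).mfderiv
  exact congrArg (fun L : E →L[ℂ] E => L v) h4

omit [IsManifold 𝓘(ℂ, E) ω T] in
-- Tangent spaces at different points are all copies of `E`; taking the vectors in `E` avoids
-- transport along `x = y`.
theorem TwoForm.apply_congr (α : TwoForm E T) {x y : T} (h : x = y) {v w : Fin 2 → E}
    (hvw : v = w) : α x v = α y w := by
  subst h hvw
  rfl

theorem continuous_pullback_apply {p : E → T} (hp : ContMDiff 𝓘(ℂ, E) 𝓘(ℂ, E) ω p)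
    {α : TwoForm E T} (hα : IsSmooth α) (v w : E) :
    Continuous fun z => pullback (M := E) p α z ![v, w] := by
  rw [continuous_iff_continuousAt]
  intro z₀
  set c := extChartAt 𝓘(ℂ, E) (p z₀) with hc
  have hs : ∀ᶠ z in 𝓝 z₀, p z ∈ c.source := hp.continuous.continuousAt.preimage_mem_nhds
    (extChartAt_source_mem_nhds (I := 𝓘(ℂ, E)) (p z₀))
  have hcd : ContDiffAt ℂ ω (c ∘ p) z₀ :=
    contDiffAt_extChartAt_comp hp _ (mem_extChartAt_source _)
  have hfd : ContinuousAt (fun z => fderiv ℂ (c ∘ p) z) z₀ :=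
    (hcd.fderiv_right (m := 0) (by simp)).continuousAt
  have hin : ContinuousAt (inChart α (p z₀)) ((c ∘ p) z₀) :=
    ((hα (p z₀)).continuousOn.continuousAt (extChartAt_target_mem_nhds (I := 𝓘(ℂ, E)) (p z₀)))
  have hin2 : ContinuousAt (fun z => inChart α (p z₀) ((c ∘ p) z)) z₀ :=
    ContinuousAt.comp (f := c ∘ p) hin hcd.continuousAt
  have hmain : ContinuousAt (fun z => inChart α (p z₀) ((c ∘ p) z)
      ![fderiv ℂ (c ∘ p) z v, fderiv ℂ (c ∘ p) z w]) z₀ := by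
    have h3 : ContinuousAt (fun z => ![fderiv ℂ (c ∘ p) z v, fderiv ℂ (c ∘ p) z w]) z₀ := by
      rw [continuousAt_pi]
      intro i
      fin_cases i
      · exact hfd.clm_apply continuousAt_const
      · exact hfd.clm_apply continuousAt_const
    have h4 : Continuous fun q : (E [⋀^Fin 2]→L[ℝ] ℝ) × (Fin 2 → E) => q.1 q.2 := by
      fun_prop
    exact h4.continuousAt.comp (hin2.prodMk h3)
  refine hmain.congr ?_
  filter_upwards [hs] with z hz
  refine TwoForm.apply_congr α (c.left_inv hz) (funext fun i => ?_)
  fin_cases i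
  · exact (mfderiv_apply_eq_fderiv_extChartAt_comp hp (p z₀) hz v).symm
  · exact (mfderiv_apply_eq_fderiv_extChartAt_comp hp (p z₀) hz w).symm

omit [IsManifold 𝓘(ℂ, E) ω T] in
theorem comp_eventuallyEq_extChartAt {p : E → T} (hp : Continuous p) (φ : T → ℝ) (z : E) :
    φ ∘ p =ᶠ[𝓝 z]
      (φ ∘ (extChartAt 𝓘(ℂ, E) (p z)).symm) ∘ (extChartAt 𝓘(ℂ, E) (p z) ∘ p) := by
  have := hp.continuousAt.preimage_mem_nhds
    (extChartAt_source_mem_nhds (I := 𝓘(ℂ, E)) (p z))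
  filter_upwards [this] with w hw
  simp only [comp_apply]
  rw [(extChartAt 𝓘(ℂ, E) (p z)).left_inv hw]

omit [IsManifold 𝓘(ℂ, E) ω T] in
theorem contDiffAt_comp_extChartAt_symm {φ : T → ℝ} (hφ : ContMDiff 𝓘(ℝ, E) 𝓘(ℝ, ℝ) ∞ φ) (x : T) :
    ContDiffAt ℝ ∞ (φ ∘ (extChartAt 𝓘(ℂ, E) x).symm) (extChartAt 𝓘(ℂ, E) x x) := by
  have := (contMDiffAt_iff.1 (hφ x)).2
  simpa [contDiffWithinAt_univ, chartAt_self_eq] using this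

theorem contDiff_comp_of_contMDiff {p : E → T} (hp : ContMDiff 𝓘(ℂ, E) 𝓘(ℂ, E) ω p) {φ : T → ℝ}
    (hφ : ContMDiff 𝓘(ℝ, E) 𝓘(ℝ, ℝ) ∞ φ) : ContDiff ℝ ∞ (φ ∘ p) := by
  rw [contDiff_iff_contDiffAt]
  intro z
  have hcd : ContDiffAt ℝ ∞ (extChartAt 𝓘(ℂ, E) (p z) ∘ p) z :=
    ((contDiffAt_extChartAt_comp hp _ (mem_extChartAt_source _)).restrict_scalars ℝ).of_le le_top
  exact (ContDiffAt.comp z (contDiffAt_comp_extChartAt_symm hφ (p z)) hcd).congr_of_eventuallyEq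
    (comp_eventuallyEq_extChartAt hp.continuous φ z)

/-- `ddc φ` is computed at each point in a different chart. Invariance of `dd^c` under the
holomorphic map `c ∘ p` turns these pointwise values into one globally exact form on `E`. -/
theorem pullback_ddc {p : E → T} (hp : ContMDiff 𝓘(ℂ, E) 𝓘(ℂ, E) ω p) {φ : T → ℝ}
    (hφ : ContMDiff 𝓘(ℝ, E) 𝓘(ℝ, ℝ) ∞ φ) (z : E) :
    pullback (M := E) p (ddc φ) z = extDeriv (vectorDc (φ ∘ p)) z := by
  set c := extChartAt 𝓘(ℂ, E) (p z) with hc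
  have hcd : ContDiffAt ℂ ω (c ∘ p) z :=
    contDiffAt_extChartAt_comp hp _ (mem_extChartAt_source _)
  have hu : ContDiffAt ℝ ∞ (φ ∘ c.symm) ((c ∘ p) z) := contDiffAt_comp_extChartAt_symm hφ (p z)
  have h2 : vectorDc (φ ∘ p) =ᶠ[𝓝 z] vectorDc ((φ ∘ c.symm) ∘ (c ∘ p)) := by
    filter_upwards [(comp_eventuallyEq_extChartAt hp.continuous φ z).eventuallyEq_nhds] with w hw
    simp only [vectorDc, hw.fderiv_eq, hc]
  rw [h2.extDeriv_eq, extDeriv_vectorDc_comp hu hcd]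
  have h5 := fderiv_extChartAt_comp hp (p z) (mem_extChartAt_source _)
  have h6 : fderiv ℝ (c ∘ p) z = (fderiv ℂ (c ∘ p) z).restrictScalars ℝ :=
    ((hcd.differentiableAt (by simp)).hasFDerivAt.restrictScalars ℝ).fderiv
  rw [h6, h5]
  rfl

end Manifold

/-! ### The projection `E → E ⧸ Λ` and lifts of torus maps -/

section Quotient

variable {E : Type*} [NormedAddCommGroup E] (Λ : Submodule ℤ E)

/-- A periodic continuous function descends to the quotient. -/
theorem exists_continuous_quotient_eq {G : E → ℝ} (hG : Continuous G)
    (hper : ∀ z, ∀ l ∈ Λ, G (z + l) = G z) :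
    ∃ g : E ⧸ Λ → ℝ, Continuous g ∧ ∀ z, g (Submodule.Quotient.mk z) = G z := by
  have h : ∀ z, G (surjInv (Submodule.Quotient.mk_surjective Λ)
      (Submodule.Quotient.mk z)) = G z := by
    intro z
    have h1 := surjInv_eq (Submodule.Quotient.mk_surjective Λ) (Submodule.Quotient.mk z)
    have h2 := (Submodule.Quotient.eq Λ).1 h1
    have h3 := hper z _ h2
    rwa [add_sub_cancel] at h3
  refine ⟨fun q => G (surjInv (Submodule.Quotient.mk_surjective Λ) q), ?_, h⟩
  rw [(Submodule.isQuotientMap_mkQ Λ).continuous_iff]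
  convert hG using 1
  exact funext h

theorem isCoveringMap_mk [DiscreteTopology Λ] :
    IsCoveringMap (Submodule.Quotient.mk : E → E ⧸ Λ) :=
  (AddSubgroup.isAddQuotientCoveringMap_of_comm Λ.toAddSubgroup
    ⟨‹DiscreteTopology Λ›⟩).isCoveringMap

theorem compactSpace_quotient [NormedSpace ℝ E] [FiniteDimensional ℝ E] [DiscreteTopology Λ]
    [IsZLattice ℝ Λ] : CompactSpace (E ⧸ Λ) := by
  have h := IsZLattice.isCompact_range_of_periodic Λ (Submodule.Quotient.mk : E → E ⧸ Λ)
    (isLocalHomeomorph_mk Λ).continuous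
    (fun z w hw => (Submodule.Quotient.eq Λ).2 (by simpa using hw))
  rw [(Submodule.Quotient.mk_surjective Λ).range_eq] at h
  exact ⟨h⟩

variable [NormedSpace ℂ E] [DiscreteTopology Λ]

theorem extChartAt_comp_mk_eventuallyEq (q : E ⧸ Λ) {z : E}
    (hz : (Submodule.Quotient.mk z : E ⧸ Λ) ∈ (extChartAt 𝓘(ℂ, E) q).source) :
    ∃ c : E, (extChartAt 𝓘(ℂ, E) q ∘ Submodule.Quotient.mk) =ᶠ[𝓝 z] fun y => y + c := by
  have hch : chartAt E q = (isLocalHomeomorph_mk Λ).localInverseAt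
      (((Submodule.Quotient.mk_surjective Λ).hasRightInverse).choose q) :=
    OpenPartialHomeomorph.trans_refl _
  rw [extChartAt_source, hch] at hz
  obtain ⟨c, hc⟩ := localInverseAt_mk_eventuallyEq Λ _ hz
  refine ⟨c, ?_⟩
  filter_upwards [hc] with y hy
  simpa [hch] using hy

theorem contMDiff_mk :
    ContMDiff 𝓘(ℂ, E) 𝓘(ℂ, E) ω (Submodule.Quotient.mk : E → E ⧸ Λ) := by
  intro z
  rw [contMDiffAt_iff]
  refine ⟨(isLocalHomeomorph_mk Λ).continuous.continuousAt, ?_⟩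
  obtain ⟨c, hc⟩ := extChartAt_comp_mk_eventuallyEq Λ (Submodule.Quotient.mk z)
    (mem_extChartAt_source _)
  refine ContDiffAt.contDiffWithinAt ?_
  exact (contDiffAt_id.add contDiffAt_const).congr_of_eventuallyEq hc

theorem mfderiv_mk_injective (z : E) :
    Injective (mfderiv 𝓘(ℂ, E) 𝓘(ℂ, E) (Submodule.Quotient.mk : E → E ⧸ Λ) z) := by
  obtain ⟨c, hc⟩ := extChartAt_comp_mk_eventuallyEq Λ (Submodule.Quotient.mk z)
    (mem_extChartAt_source _)
  have h1 := fderiv_extChartAt_comp (contMDiff_mk Λ) (Submodule.Quotient.mk z)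
    (mem_extChartAt_source _)
  rw [hc.fderiv_eq, fderiv_add_const, fderiv_fun_id] at h1
  intro v w hvw
  have h2 : ∀ v : E, v = _ := fun v => congrArg (fun L : E →L[ℂ] E => L v) h1
  refine (h2 v).trans (Eq.trans ?_ (h2 w).symm)
  exact congrArg (mfderiv 𝓘(ℂ, E) 𝓘(ℂ, E) (extChartAt 𝓘(ℂ, E) (Submodule.Quotient.mk z : E ⧸ Λ))
    (Submodule.Quotient.mk z : E ⧸ Λ)) hvw

/-- Near `z`, continuity keeps `F` where chart and projection compose to a translation, so `F` is
the holomorphic chart expression up to a constant. -/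
theorem differentiable_of_mdifferentiable_mk_comp {F : E → E} (hF : Continuous F)
    (h : MDifferentiable 𝓘(ℂ, E) 𝓘(ℂ, E) fun z => (Submodule.Quotient.mk (F z) : E ⧸ Λ)) :
    Differentiable ℂ F := by
  intro z
  obtain ⟨c, hc⟩ := extChartAt_comp_mk_eventuallyEq Λ (Submodule.Quotient.mk (F z))
    (mem_extChartAt_source _)
  have h1 : MDifferentiableAt 𝓘(ℂ, E) 𝓘(ℂ, E)
      (extChartAt 𝓘(ℂ, E) (Submodule.Quotient.mk (F z) : E ⧸ Λ) ∘
        fun z => (Submodule.Quotient.mk (F z) : E ⧸ Λ)) z :=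
    (mdifferentiableAt_extChartAt (by simp)).comp z (h z)
  rw [mdifferentiableAt_iff_differentiableAt] at h1
  refine (h1.sub_const c).congr_of_eventuallyEq ?_
  filter_upwards [hF.continuousAt.eventually hc] with w hw
  simp only [comp_apply] at hw ⊢
  rw [hw, add_sub_cancel_right]

/-- A holomorphic map of vector spaces which descends to a map of tori is affine. -/
theorem eq_fderiv_add_of_sub_mem [FiniteDimensional ℂ E] [IsZLattice ℝ Λ] {F : E → E}
    (hF : Differentiable ℂ F) (hΛ : ∀ z, ∀ l ∈ Λ, F (z + l) - F z ∈ Λ) (z : E) :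
    F z = fderiv ℂ F 0 z + F 0 := by
  -- A continuous map from the connected space `E` to the discrete `Λ` is constant.
  have h1 : ∀ l ∈ Λ, ∀ z w, F (z + l) - F z = F (w + l) - F w := by
    intro l hl z w
    have hc : Continuous fun z => (⟨F (z + l) - F z, hΛ z l hl⟩ : Λ) :=
      Continuous.subtype_mk ((hF.continuous.comp (continuous_id.add continuous_const)).sub
        hF.continuous) _
    have := PreconnectedSpace.constant inferInstance hc (x := z) (y := w)
    exact congrArg Subtype.val this
  -- By `h1`, `F (z + w) - F z` is `Λ`-periodic in `z`, hence bounded, hence constant by Liouville.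
  have h2 : ∀ w x y, F (x + w) - F x = F (y + w) - F y := by
    intro w x y
    have hd : Differentiable ℂ fun z => F (z + w) - F z :=
      (hF.comp (differentiable_id.add_const w)).sub hF
    refine hd.apply_eq_apply_of_bounded (IsZLattice.isCompact_range_of_periodic Λ _
      hd.continuous fun z l hl => ?_).isBounded x y
    have := h1 l hl (z + w) z
    rw [add_right_comm, sub_eq_sub_iff_sub_eq_sub]
    exact this
  have h3 : ∀ w, fderiv ℂ F w = fderiv ℂ F 0 := by
    intro w
    have h4 : F = fun z => F (z + w) - (F w - F 0) := by
      funext z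
      have := h2 z 0 w
      rw [zero_add, add_comm w] at this
      rw [sub_eq_sub_iff_add_eq_add] at this
      rw [eq_sub_iff_add_eq, ← add_sub_assoc, this, add_sub_cancel_right]
    conv_rhs => rw [h4, fderiv_sub_const, fderiv_comp_add_right, zero_add]
  have h5 := is_const_of_fderiv_eq_zero (hF.sub (fderiv ℂ F 0).differentiable)
    (fun x => by
      rw [fderiv_sub (hF x) (fderiv ℂ F 0).differentiableAt, h3, ContinuousLinearMap.fderiv,
        sub_self]) z 0
  simp only [Pi.sub_apply, map_zero, sub_zero] at h5
  rw [← h5]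
  abel

end Quotient

/-! ### Averaging an exact two-form over the torus -/

section Average

variable {E : Type*} [NormedAddCommGroup E] [NormedSpace ℂ E]

theorem extDeriv_apply_pair {α : E → E [⋀^Fin 1]→L[ℝ] ℝ} {z : E} (hα : DifferentiableAt ℝ α z)
    (v w : E) :
    extDeriv α z ![v, w] = fderiv ℝ (fun y => α y ![w]) z v - fderiv ℝ (fun y => α y ![v]) z w := by
  have h0 : (Fin.removeNth 0 ![v, w] : Fin 1 → E) = ![w] := by
    ext i; fin_cases i; rfl
  have h1 : (Fin.removeNth 1 ![v, w] : Fin 1 → E) = ![v] := by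
    ext i; fin_cases i; rfl
  rw [extDeriv_apply hα, Fin.sum_univ_two, h0, h1]
  simp [sub_eq_add_neg]

/-- On a torus, a continuous function which is the sum of a coboundary of a surjective affine map
and of a component of an exact form is not positive. -/
theorem not_forall_pos_of_eq_coboundary_add_extDeriv [FiniteDimensional ℂ E] (Λ : Submodule ℤ E)
    [DiscreteTopology Λ] [IsZLattice ℝ Λ] (A : E →L[ℂ] E) (b : E) (hA : ∀ l ∈ Λ, A l ∈ Λ)
    (hsurj : ∀ z, ∃ w, z - (A w + b) ∈ Λ) (v w : E) {G H : E → ℝ} {α : E → E [⋀^Fin 1]→L[ℝ] ℝ}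
    (hG : Continuous G) (hH : Continuous H) (hα : ContDiff ℝ ∞ α)
    (hGper : ∀ z, ∀ l ∈ Λ, G (z + l) = G z) (hHper : ∀ z, ∀ l ∈ Λ, H (z + l) = H z)
    (hαper : ∀ z, ∀ l ∈ Λ, α (z + l) = α z)
    (heq : ∀ z, G (A z + b) - G z - H z = extDeriv α z ![v, w]) : ¬ ∀ z, 0 < H z := by
  intro hpos
  have : FiniteDimensional ℝ E := FiniteDimensional.complexToReal E
  have := compactSpace_quotient Λ
  let _ : MeasurableSpace (E ⧸ Λ) := borel _
  have : BorelSpace (E ⧸ Λ) := ⟨rfl⟩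
  obtain ⟨g, hg, hgG⟩ := exists_continuous_quotient_eq Λ hG hGper
  obtain ⟨e, he, heH⟩ := exists_continuous_quotient_eq Λ hH hHper
  have hcd : ∀ x : E, ContDiff ℝ ∞ fun z => α z ![x] := fun x =>
    (ContinuousAlternatingMap.apply ℝ E ℝ ![x]).contDiff.comp hα
  have hα1 : ∀ x : E, ∀ z, ∀ l ∈ Λ, α (z + l) ![x] = α z ![x] := fun x z l hl => by
    rw [hαper z l hl]
  have hα2 : ∀ x y : E, ∀ z, ∀ l ∈ Λ,
      fderiv ℝ (fun z => α z ![x]) (z + l) y = fderiv ℝ (fun z => α z ![x]) z y := by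
    intro x y z l hl
    rw [← fderiv_comp_add_right l]
    simp_rw [hα1 x _ l hl]
  have hdesc : ∀ x y : E, ∃ u d : E ⧸ Λ → ℝ, Continuous u ∧ Continuous d ∧
      (∀ z, d (Submodule.Quotient.mk z) = fderiv ℝ (fun z => α z ![x]) z y) ∧
      ∀ q t, HasDerivAt (fun s : ℝ => u (q + Submodule.Quotient.mk (s • y)))
        (d (q + Submodule.Quotient.mk (t • y))) t := by
    intro x y
    obtain ⟨u, hu, huz⟩ := exists_continuous_quotient_eq Λ (hcd x).continuous (hα1 x)
    obtain ⟨d, hd, hdz⟩ := exists_continuous_quotient_eq Λ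
      (((hcd x).continuous_fderiv (by simp)).clm_apply continuous_const) (hα2 x y)
    refine ⟨u, d, hu, hd, hdz, fun q t => ?_⟩
    obtain ⟨z, rfl⟩ := Submodule.Quotient.mk_surjective Λ q
    simp_rw [← Submodule.Quotient.mk_add, huz, hdz]
    have h1 : HasDerivAt (fun s : ℝ => z + s • y) y t := by
      simpa using ((hasDerivAt_id t).smul_const y).const_add z
    exact (((hcd x).differentiable (by simp)) (z + t • y)).hasFDerivAt.comp_hasDerivAt t h1
  -- The two terms of `dα (v, w)`: the derivative of `α (w)` along `v`, and that of `α (v)` along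
  -- `w`.
  obtain ⟨u₁, d₁, hu₁, hd₁, hdz₁, h₁⟩ := hdesc w v
  obtain ⟨u₂, d₂, hu₂, hd₂, hdz₂, h₂⟩ := hdesc v w
  let ψ : E ⧸ Λ →+ E ⧸ Λ :=
    (Submodule.mapQ Λ Λ (A.toLinearMap.restrictScalars ℤ) (fun l hl => hA l hl)).toAddMonoidHom
  have hψ : ∀ z : E, ψ (Submodule.Quotient.mk z) = Submodule.Quotient.mk (A z) := fun z => rfl
  have hψc : Continuous ψ := by
    rw [(Submodule.isQuotientMap_mkQ Λ).continuous_iff]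
    exact (Submodule.continuous_mkQ Λ).comp A.continuous
  refine not_forall_pos_of_eq_coboundary_add_deriv ψ hψc ?_ (Submodule.Quotient.mk b)
    (fun t => Submodule.Quotient.mk (t • v)) (fun t => Submodule.Quotient.mk (t • w))
    (by simp) (by simp) hg he hu₁ hd₁ hu₂ hd₂ h₁ h₂ ?_ ?_
  · intro q
    obtain ⟨z, rfl⟩ := Submodule.Quotient.mk_surjective Λ q
    -- The shift by `b` cancels the translation part, leaving surjectivity of the linear part modulo
    -- `Λ`.
    obtain ⟨x, hx⟩ := hsurj (z + b)
    refine ⟨Submodule.Quotient.mk x, ?_⟩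
    rw [hψ, eq_comm, Submodule.Quotient.eq]
    simpa using hx
  · intro q
    obtain ⟨z, rfl⟩ := Submodule.Quotient.mk_surjective Λ q
    rw [hψ, ← Submodule.Quotient.mk_add, hgG, hgG, heH, hdz₁, hdz₂,
      ← extDeriv_apply_pair (hα.differentiable (by simp) z), ← heq]
    ring
  · intro q
    obtain ⟨z, rfl⟩ := Submodule.Quotient.mk_surjective Λ q
    rw [heH]
    exact hpos z

end Average

/-! ### Lifting `f` and the fixed point -/

section Main

variable {E : Type*} [NormedAddCommGroup E] [NormedSpace ℂ E]
variable {T : Type*} [TopologicalSpace T] [ChartedSpace E T]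

theorem pullback_apply_add_of_periodic {p : E → T} (hp : ContMDiff 𝓘(ℂ, E) 𝓘(ℂ, E) ω p)
    (α : TwoForm E T) {l : E} (hl : ∀ z, p (z + l) = p z) (z v w : E) :
    pullback (M := E) p α (z + l) ![v, w] = pullback (M := E) p α z ![v, w] := by
  have h1 : HasMFDerivAt 𝓘(ℂ, E) 𝓘(ℂ, E) (p ∘ fun z => z + l) z _ :=
    ((hp (z + l)).mdifferentiableAt (by simp)).hasMFDerivAt.comp z
      ((hasFDerivAt_id z).add_const l).hasMFDerivAt
  have h2 : p ∘ (fun z => z + l) = p := funext hl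
  rw [h2] at h1
  have h3 : ∀ x : E, (mfderiv 𝓘(ℂ, E) 𝓘(ℂ, E) p z : E → E) x =
      (mfderiv 𝓘(ℂ, E) 𝓘(ℂ, E) p (z + l) : E → E) x :=
    fun x => congrArg (fun L : E →L[ℂ] E => L x) h1.mfderiv
  refine TwoForm.apply_congr α (hl z) (funext fun i => ?_)
  fin_cases i
  · exact (h3 v).symm
  · exact (h3 w).symm

/-- A direction fixed by a lift of `f` computes the pull-back by `f`. -/
theorem pullback_pullback_apply_of_fixed {p : E → T} (hp : ContMDiff 𝓘(ℂ, E) 𝓘(ℂ, E) ω p)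
    {f : T → T} (hf : MDifferentiable 𝓘(ℂ, E) 𝓘(ℂ, E) f) {F : E → E} (hF : Differentiable ℂ F)
    (hpF : ∀ z, p (F z) = f (p z)) (α : TwoForm E T) {z v w : E}
    (hv : fderiv ℂ F z v = v) (hw : fderiv ℂ F z w = w) :
    pullback (M := E) p (pullback f α) z ![v, w] = pullback (M := E) p α (F z) ![v, w] := by
  have h1 : HasMFDerivAt 𝓘(ℂ, E) 𝓘(ℂ, E) (f ∘ p) z _ :=
    (hf (p z)).hasMFDerivAt.comp z ((hp z).mdifferentiableAt (by simp)).hasMFDerivAt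
  have h2 : HasMFDerivAt 𝓘(ℂ, E) 𝓘(ℂ, E) (p ∘ F) z _ :=
    ((hp (F z)).mdifferentiableAt (by simp)).hasMFDerivAt.comp z
      (hF z).hasFDerivAt.hasMFDerivAt
  have h3 : f ∘ p = p ∘ F := funext fun z => (hpF z).symm
  rw [h3] at h1
  have h4 : ∀ x : E, (mfderiv 𝓘(ℂ, E) 𝓘(ℂ, E) f (p z) : E → E)
        ((mfderiv 𝓘(ℂ, E) 𝓘(ℂ, E) p z : E → E) x) =
      (mfderiv 𝓘(ℂ, E) 𝓘(ℂ, E) p (F z) : E → E) (fderiv ℂ F z x) :=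
    fun x => congrArg (fun L : E →L[ℂ] E => L x) (hasMFDerivAt_unique h1 h2)
  refine TwoForm.apply_congr α (hpF z).symm (funext fun i => ?_)
  fin_cases i
  · exact (h4 v).trans (congrArg (mfderiv 𝓘(ℂ, E) 𝓘(ℂ, E) p (F z) : E → E) hv)
  · exact (h4 w).trans (congrArg (mfderiv 𝓘(ℂ, E) 𝓘(ℂ, E) p (F z) : E → E) hw)

theorem pullback_apply_pos {p : E → T} {z : E}
    (hp : Injective (mfderiv 𝓘(ℂ, E) 𝓘(ℂ, E) p z)) {α : TwoForm E T} (hα : IsKahlerForm α)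
    {v : E} (hv : v ≠ 0) : 0 < pullback (M := E) p α z ![v, Complex.I • v] := by
  have h1 : mfderiv 𝓘(ℂ, E) 𝓘(ℂ, E) p z v ≠ 0 := fun h => hv (hp (h.trans (map_zero _).symm))
  have h2 := hα.pos (p z) _ h1
  refine h2.trans_eq (TwoForm.apply_congr α rfl (funext fun i => ?_))
  fin_cases i
  · rfl
  · exact (map_smul (mfderiv 𝓘(ℂ, E) 𝓘(ℂ, E) p z : E →L[ℂ] E) Complex.I v).symm

/-- The vector space `E` is simply connected, so maps from it lift through the covering. -/
theorem exists_lift_of_covering (Λ : Submodule ℤ E) [DiscreteTopology Λ] {G : E → E ⧸ Λ}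
    (hG : Continuous G) : ∃ F : E → E, Continuous F ∧ ∀ z, Submodule.Quotient.mk (F z) = G z := by
  obtain ⟨e, he⟩ := Submodule.Quotient.mk_surjective Λ (G 0)
  obtain ⟨F, ⟨-, hF⟩, -⟩ := (isCoveringMap_mk Λ).existsUnique_continuousMap_lifts ⟨G, hG⟩ 0 e he
  exact ⟨F, F.continuous, congrFun hF⟩

theorem exists_fixedPoint_of_isIntAmplified [FiniteDimensional ℂ E] [IsManifold 𝓘(ℂ, E) ω T]
    (hT : IsComplexTorus E T)
    {f : T → T} (hf : IsIntAmplified E f) : ∃ p : T, f p = p := by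
  obtain ⟨Λ, _, _, ⟨Ψ⟩⟩ := hT
  set p : E → T := fun z => Ψ.symm (Submodule.Quotient.mk z) with hpdef
  have hp : ContMDiff 𝓘(ℂ, E) 𝓘(ℂ, E) ω p := Ψ.symm.contMDiff.comp (contMDiff_mk Λ)
  have hΨp : ∀ z, Ψ (p z) = Submodule.Quotient.mk z := fun z => Ψ.apply_symm_apply _
  have hpsurj : Surjective p := Ψ.symm.surjective.comp (Submodule.Quotient.mk_surjective Λ)
  have hpeq : ∀ z w, p z = p w ↔ z - w ∈ Λ := fun z w =>
    Ψ.symm.injective.eq_iff.trans (Submodule.Quotient.eq Λ)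
  have hpinj : ∀ z, Injective (mfderiv 𝓘(ℂ, E) 𝓘(ℂ, E) p z) := by
    intro z
    have h1 : HasMFDerivAt 𝓘(ℂ, E) 𝓘(ℂ, E) (Ψ ∘ p) z _ :=
      ((Ψ.contMDiff (p z)).mdifferentiableAt (by simp)).hasMFDerivAt.comp z
        ((hp z).mdifferentiableAt (by simp)).hasMFDerivAt
    have h2 : Ψ ∘ p = (Submodule.Quotient.mk : E → E ⧸ Λ) := funext hΨp
    rw [h2] at h1
    have h3 := mfderiv_mk_injective Λ z
    rw [h1.mfderiv] at h3
    exact Injective.of_comp h3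
  obtain ⟨F, hFc, hF⟩ := exists_lift_of_covering Λ
    (G := fun z => Ψ (f (p z)))
    (Ψ.contMDiff.continuous.comp (hf.holomorphic.continuous.comp hp.continuous))
  have hpF : ∀ z, p (F z) = f (p z) := fun z => by
    rw [hpdef]
    simp only [hF]
    exact Ψ.symm_apply_apply _
  have hFd : Differentiable ℂ F := by
    refine differentiable_of_mdifferentiable_mk_comp Λ hFc ?_
    simp_rw [hF]
    exact (Ψ.contMDiff.mdifferentiable (by simp)).comp
      (hf.holomorphic.comp (hp.mdifferentiable (by simp)))
  have hFΛ : ∀ z, ∀ l ∈ Λ, F (z + l) - F z ∈ Λ := fun z l hl => by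
    rw [← hpeq, hpF, hpF, (hpeq (z + l) z).2 (by simpa using hl)]
  set A := fderiv ℂ F 0 with hAdef
  have hFA : ∀ z, F z = A z + F 0 := eq_fderiv_add_of_sub_mem Λ hFd hFΛ
  have hA : ∀ z, fderiv ℂ F z = A := fun z => by
    rw [funext hFA, fderiv_add_const, ContinuousLinearMap.fderiv]
  -- In finite dimension, either `A - 1` is onto and a fixed point of `F` exists, or `A` has a
  -- nonzero fixed vector.
  by_cases hinj : Injective (A.toLinearMap - LinearMap.id : E →ₗ[ℂ] E)
  · obtain ⟨z, hz⟩ := (LinearMap.injective_iff_surjective.1 hinj) (-F 0)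
    have hz' : F z = z := by
      have : A z - z = -F 0 := hz
      rw [hFA, ← sub_eq_zero, add_sub_right_comm, this, neg_add_cancel]
    exact ⟨p z, by rw [← hpF, hz']⟩
  · exfalso
    rw [← LinearMap.ker_eq_bot, Submodule.eq_bot_iff] at hinj
    push Not at hinj
    obtain ⟨v, hvk, hv⟩ := hinj
    have hAv : A v = v := sub_eq_zero.1 hvk
    -- Complex linearity of `A` makes the whole complex line of `v` fixed, so positivity of `η` can
    -- be tested on `(v, Jv)`.
    have hAIv : A (Complex.I • v) = Complex.I • v := by rw [map_smul, hAv]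
    obtain ⟨ξ, η, hξ, hη, φ, hφ, heq⟩ := hf.exists_kahler
    have hper : ∀ z, ∀ l ∈ Λ, p (z + l) = p z := fun z l hl => (hpeq _ _).2 (by simpa using hl)
    have hU : ContDiff ℝ ∞ (φ ∘ p) := contDiff_comp_of_contMDiff hp hφ
    refine not_forall_pos_of_eq_coboundary_add_extDeriv Λ A (F 0) (fun l hl => ?_) (fun z => ?_)
      v (Complex.I • v)
      (continuous_pullback_apply hp hξ.smooth v (Complex.I • v))
      (continuous_pullback_apply hp hη.smooth v (Complex.I • v))
      (contDiff_iff_contDiffAt.2 fun z => contDiffAt_vectorDc (hU.contDiffAt))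
      (fun z l hl => pullback_apply_add_of_periodic hp ξ (fun z => hper z l hl) z _ _)
      (fun z l hl => pullback_apply_add_of_periodic hp η (fun z => hper z l hl) z _ _)
      (fun z l hl => ?_) (fun z => ?_) (fun z => pullback_apply_pos (hpinj z) hη hv)
    · have := hFΛ 0 l hl
      rwa [zero_add, hFA l, add_sub_cancel_right] at this
    · obtain ⟨x, hx⟩ := hf.surjective (p z)
      obtain ⟨w, rfl⟩ := hpsurj x
      exact ⟨w, by rw [← hFA, ← hpeq, hpF, hx]⟩
    · have h1 : (fun y => (φ ∘ p) (y + l)) = φ ∘ p := funext fun y => by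
        simp [hper y l hl]
      have h2 := fderiv_comp_add_right (𝕜 := ℝ) (f := φ ∘ p) (x := z) l
      rw [h1] at h2
      simp only [vectorDc, h2]
    · rw [← pullback_ddc hp hφ, ← heq, ← hFA,
        ← pullback_pullback_apply_of_fixed hp hf.holomorphic hFd hpF ξ (z := z)
          (by rw [hA, hAv]) (by rw [hA, hAIv])]
      rfl

end Main

end KahlerTorus

end

theorem mainTheorem8 {E : Type*} [NormedAddCommGroup E] [NormedSpace ℂ E] [FiniteDimensional ℂ E]
    {T : Type*} [TopologicalSpace T] [ChartedSpace E T] [IsManifold 𝓘(ℂ, E) ω T]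
    (hT : KahlerTorus.IsComplexTorus E T)
    (f : T → T) (hf : KahlerTorus.IsIntAmplified E f) :
    ∃ p : T, f p = p :=
  KahlerTorus.exists_fixedPoint_of_isIntAmplified hT hf
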